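/- \textbf{Proposition (error bound for Radau quadratures).} Let $P_n(x)=\frac{1}{2^n n!}\frac{d^n}{dx^n}(x^2-1)^n$ be the $n$-th Legendre polynomial. For $N\ge 2$ and $f:[-1,1]\to\mathbb{R}$ let \[ \mathrm{Rad}^l_N(f)=\frac{2}{N^2}f(-1)+\sum_{i=2}^{N}w_i f(x_i),\qquad w_i=\frac{1}{(1-x_i)\,[P_{N-1}'(x_i)]^2}, \] where $x_2,\dots,x_N$ are the roots of the polynomial $Q_{N-1}(x)=\dfrac{P_{N-1}(x)+P_N(x)}{x+1}$ (they are real, distinct and lie in $(-1,1)$), and let $\mathrm{Rad}^r_N(f)=\mathrm{Rad}^l_N\bigl(x\mapsto f(-x)\bigr)$. For $n\ge 1$ put \[ \alpha_{2n}=\frac{4^{n+1}(n!)^4}{(2n+1)\,[(2n)!]^3},\qquad \alpha_{2n+1}=\frac{4^{n+1}(n+1)(n!)^4}{[(2n+1)!]^3}, \] and for a continuous $g:[-1,1]\to\mathbb{R}$ let $\|g\|=\sup\{|g(x)|: x\in[-1,1]\}$. Let $k,N$ be positive integers with $k\ge 2$ and $N>\left\lfloor\frac{k+1}{2}\right\rfloor$.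 Then for every $f\in C^k([-1,1])$, \[ \left|\int_{-1}^1 f(x)\,dx-\mathrm{Rad}^l_N(f)\right|\le\alpha_k\,\|f^{(k)}\| \qquad\text{and}\qquad \left|\int_{-1}^1 f(x)\,dx-\mathrm{Rad}^r_N(f)\right|\le\alpha_k\,\|f^{(k)}\|. \] -/

import Mathlib

open scoped Nat Polynomial

noncomputable section

namespace RadauBound

/-- The `n`-th Legendre polynomial (normalised by `P_n(1) = 1`), by Rodrigues' formula
`P_n = (1 / (2 ^ n n!)) (d/dx) ^ n (x ^ 2 - 1) ^ n`. -/
def legendreP (n : ℕ) : ℝ[X] :=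
  Polynomial.C ((2 ^ n * (n ! : ℝ))⁻¹) *
    Polynomial.derivative^[n] ((Polynomial.X ^ 2 - 1) ^ n)

/-- The polynomial `Q_{n-1}(x) = (P_{n-1}(x) + P_n(x)) / (x + 1)` whose roots are the interior
abscissas of the `n`-point left Radau rule (used for `n ≥ 2`). The division is exact. -/
def radauPoly (n : ℕ) : ℝ[X] :=
  (legendreP (n - 1) + legendreP n) /ₘ (Polynomial.X - Polynomial.C (-1))

/-- The interior weight `1 / ((1 - x) [P_{n-1}'(x)] ^ 2)` attached to an abscissa `x`. -/
def radauWeight (n : ℕ) (x : ℝ) : ℝ :=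
  1 / ((1 - x) * ((Polynomial.derivative (legendreP (n - 1))).eval x) ^ 2)

/-- The left Radau quadrature with `n` abscissas (used for `n ≥ 2`): the left endpoint `-1` with
weight `2 / n ^ 2`, and the (distinct) roots of `radauPoly n`. -/
def radauLeft (n : ℕ) (f : ℝ → ℝ) : ℝ :=
  2 / (n : ℝ) ^ 2 * f (-1) + ∑ x ∈ (radauPoly n).roots.toFinset, radauWeight n x * f x

/-- The right Radau quadrature, the reflection of the left one. -/
def radauRight (n : ℕ) (f : ℝ → ℝ) : ℝ :=
  radauLeft n (fun x => f (-x))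

/-- The supremum norm over `[-1, 1]`. -/
def supNorm (g : ℝ → ℝ) : ℝ :=
  sSup ((fun x => |g x|) '' Set.Icc (-1) 1)

/-- The constants `α_k`, for `k = 2n` and for `k = 2n + 1`, where `n = k / 2`. -/
def alpha (k : ℕ) : ℝ :=
  if Even k then
    4 ^ (k / 2 + 1) * ((k / 2)! : ℝ) ^ 4 / ((2 * ((k / 2 : ℕ) : ℝ) + 1) * ((2 * (k / 2))! : ℝ) ^ 3)
  else
    4 ^ (k / 2 + 1) * (((k / 2 : ℕ) : ℝ) + 1) * ((k / 2)! : ℝ) ^ 4 / ((2 * (k / 2) + 1)! : ℝ) ^ 3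

theorem alpha_two_mul (n : ℕ) :
    alpha (2 * n) = 4 ^ (n + 1) * (n ! : ℝ) ^ 4 / ((2 * (n : ℝ) + 1) * ((2 * n)! : ℝ) ^ 3) := by
  have h : 2 * n / 2 = n := by omega
  simp only [alpha, h, even_two_mul, if_true]

theorem alpha_two_mul_add_one (n : ℕ) :
    alpha (2 * n + 1) = 4 ^ (n + 1) * ((n : ℝ) + 1) * (n ! : ℝ) ^ 4 / ((2 * n + 1)! : ℝ) ^ 3 := by
  have h : (2 * n + 1) / 2 = n := by omega
  have h' : ¬ Even (2 * n + 1) := by simp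
  simp only [alpha, h, h', if_false]

end RadauBound

end

namespace RadauBound

open Polynomial Set

/-! Write `N = n + 1`. The rule is exact up to degree `2 n` and has nonnegative weights. Interpolate
`f` by `p` at `k` nodes with nodal polynomial `ω`. Then `|f - p| ≤ M / k! * |ω|`, where `M` bounds
the `k`-th derivative, and `p` drops out of the quadrature error. What remains is at most `M / k!`
times the sum of the integral of `|ω|` and its Radau value. If `ω ≥ 0` and `k ≤ 2 n`, these two
numbers coincide, so the bound is `2 * M / k!` times the integral of `ω`.

For `k = 2 m`, take `ω` to be the square of the monic Legendre polynomial of degree `m`; for `k = 2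
m + 1`, take `x + 1` times the square of the monic multiple of `radauPoly (m + 1)`. Orthogonality
evaluates both integrals and gives `alpha k`. These `ω` have double zeros; instead of Hermite
interpolation, each double node `s` is split into `s` and `s + ε`, and `ε → 0` in the bound
(`abs_integral_sub_radauLeft_le_of_double_nodes`).

Exactness (`radauLeft_eval`) holds because `P_n + P_{n+1}` is orthogonal to degrees below `n`: the
rule is then interpolatory on its zeros, and the Legendre derivative identities identify the
weights. The right rule follows by reflection. -/

/-! ### Rolle's theorem and the Lagrange interpolation error -/

/-- **Rolle's theorem** for finitely many zeros: `m + 1` zeros of a continuous function yield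
`m` zeros of its derivative. -/
theorem exists_finset_deriv_eq_zero {a b : ℝ} {g : ℝ → ℝ} (hg : ContinuousOn g (Icc a b))
    {S : Finset ℝ} {m : ℕ} (hS : ∀ x ∈ S, x ∈ Icc a b) (hg0 : ∀ x ∈ S, g x = 0)
    (hcard : S.card = m + 1) :
    ∃ T : Finset ℝ, T.card = m ∧ ∀ x ∈ T, x ∈ Ioo a b ∧ deriv g x = 0 := by
  rcases Set.finite_or_infinite {x | x ∈ Ioo a b ∧ deriv g x = 0} with hfin | hinf
  · have hle : S.card ≤ hfin.toFinset.card + 1 := by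
      refine Finset.card_le_of_interleaved fun x hx y hy hxy _ => ?_
      obtain ⟨z, hz, hz0⟩ := exists_deriv_eq_zero hxy
        (hg.mono (Icc_subset_Icc (hS x hx).1 (hS y hy).2)) ((hg0 x hx).trans (hg0 y hy).symm)
      refine ⟨z, ?_, hz⟩
      rw [Set.Finite.mem_toFinset]
      exact ⟨⟨(hS x hx).1.trans_lt hz.1, hz.2.trans_le (hS y hy).2⟩, hz0⟩
    obtain ⟨T, hT, hTc⟩ := Finset.exists_subset_card_eq (show m ≤ hfin.toFinset.card by omega)
    exact ⟨T, hTc, fun x hx => hfin.mem_toFinset.1 (hT hx)⟩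
  · obtain ⟨T, hT, hTc⟩ := hinf.exists_subset_card_eq m
    exact ⟨T, hTc, fun x hx => hT hx⟩

/-- Iterated Rolle. Each new zero is interior, where `derivWithin` and `deriv` agree, so only
smoothness within the closed interval is needed. -/
theorem exists_iteratedDerivWithin_eq_zero {a b : ℝ} (hab : a < b) (k : ℕ) {g : ℝ → ℝ}
    (hg : ContDiffOn ℝ k g (Icc a b)) {S : Finset ℝ} (hS : ∀ x ∈ S, x ∈ Icc a b)
    (hg0 : ∀ x ∈ S, g x = 0) (hcard : S.card = k + 1) :
    ∃ ξ ∈ Icc a b, iteratedDerivWithin k g (Icc a b) ξ = 0 := by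
  induction k generalizing g S with
  | zero =>
    obtain ⟨x, hx⟩ := Finset.card_pos.1 (by omega : 0 < S.card)
    exact ⟨x, hS x hx, by simpa using hg0 x hx⟩
  | succ k ih =>
    obtain ⟨T, hTc, hT⟩ := exists_finset_deriv_eq_zero hg.continuousOn hS hg0 hcard
    have hg' : ContDiffOn ℝ k (derivWithin g (Icc a b)) (Icc a b) :=
      hg.derivWithin (uniqueDiffOn_Icc hab) (by norm_cast)
    rw [iteratedDerivWithin_succ']
    refine ih hg' (fun x hx => Ioo_subset_Icc_self (hT x hx).1) (fun x hx => ?_) hTc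
    rw [derivWithin_of_mem_nhds (Icc_mem_nhds (hT x hx).1.1 (hT x hx).1.2), (hT x hx).2]

theorem contDiff_eval (p : ℝ[X]) {n : WithTop ℕ∞} : ContDiff ℝ n fun x => p.eval x := by
  simpa using p.contDiff_aeval (𝕜 := ℝ) n

theorem iteratedDerivWithin_eval {a b : ℝ} (hab : a < b) (p : ℝ[X]) (k : ℕ) {x : ℝ}
    (hx : x ∈ Icc a b) :
    iteratedDerivWithin k (fun x => p.eval x) (Icc a b) x = (derivative^[k] p).eval x := by
  rw [iteratedDerivWithin_eq_iteratedDeriv (uniqueDiffOn_Icc hab) (contDiff_eval p).contDiffAt hx]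
  induction k generalizing p with
  | zero => simp
  | succ k ih =>
    rw [iteratedDeriv_succ', Function.iterate_succ_apply, ← ih]
    congr 1
    ext y
    exact p.deriv

theorem iterate_derivative_nodal_card (T : Finset ℝ) :
    derivative^[T.card] (Lagrange.nodal T id) = (C (T.card ! : ℝ) : ℝ[X]) := by
  rw [Lagrange.nodal_eq]
  simpa using iterate_derivative_prod_X_sub_C (le_refl T.card)

/-- The error of Lagrange interpolation. -/
theorem abs_sub_interpolate_le {a b : ℝ} (hab : a < b) {f : ℝ → ℝ} (T : Finset ℝ) {M : ℝ}
    (hf : ContDiffOn ℝ T.card f (Icc a b)) (hT : ∀ x ∈ T, x ∈ Icc a b)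
    (hM : ∀ x ∈ Icc a b, |iteratedDerivWithin T.card f (Icc a b) x| ≤ M)
    {x : ℝ} (hx : x ∈ Icc a b) :
    |f x - (Lagrange.interpolate T id f).eval x| ≤
      M / T.card ! * |(Lagrange.nodal T id).eval x| := by
  set p := Lagrange.interpolate T id f with hp
  set w := Lagrange.nodal T (id : ℝ → ℝ) with hw
  have hinj : Set.InjOn (id : ℝ → ℝ) T := Function.injective_id.injOn
  have hpT : ∀ y ∈ T, p.eval y = f y := fun y hy =>
    Lagrange.eval_interpolate_at_node (v := id) f hinj hy
  have hwT : ∀ y ∈ T, w.eval y = 0 := fun y hy => Lagrange.eval_nodal_at_node (v := id) hy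
  by_cases hxT : x ∈ T
  · rw [hpT x hxT, hwT x hxT]
    simp
  have hwx : w.eval x ≠ 0 := Lagrange.eval_nodal_not_at_node fun i hi h => hxT (by simpa [h] using hi)
  -- This `c` makes `q = p + c w` agree with `f` at `x` as well as on `T`. Rolle then gives `ξ`
  -- where the derivative of `f` of order `T.card` equals that of `q`, the constant `c * T.card !`.
  set c := (f x - p.eval x) / w.eval x with hc
  have hcw : f x - p.eval x = c * w.eval x := by rw [hc, div_mul_cancel₀ _ hwx]
  set q := p + C c * w with hq
  have hzero : ∀ y ∈ insert x T, (f - fun z => q.eval z) y = 0 := by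
    intro y hy
    rcases Finset.mem_insert.1 hy with rfl | hy
    · simp only [Pi.sub_apply, hq, eval_add, eval_mul, eval_C]
      linarith
    · simp [hq, hpT y hy, hwT y hy]
  obtain ⟨ξ, hξ, hξ0⟩ := exists_iteratedDerivWithin_eq_zero hab T.card
    (g := f - fun z => q.eval z) (hf.sub (contDiff_eval q).contDiffOn) (S := insert x T)
    (fun y hy => (Finset.mem_insert.1 hy).elim (fun h => h ▸ hx) (hT y)) hzero
    (Finset.card_insert_of_notMem hxT)
  have hqk : derivative^[T.card] q = C (c * T.card !) := by
    rw [hq, iterate_map_add, iterate_derivative_C_mul, iterate_derivative_nodal_card,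
      iterate_derivative_eq_zero_of_degree_lt (Lagrange.degree_interpolate_lt f hinj), zero_add,
      C_mul]
  rw [iteratedDerivWithin_sub hξ (uniqueDiffOn_Icc hab) (hf ξ hξ)
    (contDiff_eval q).contDiffWithinAt,
    iteratedDerivWithin_eval hab q _ hξ, hqk, eval_C, sub_eq_zero] at hξ0
  have h := hM ξ hξ
  have hpos : (0 : ℝ) < T.card ! := by positivity
  rw [hξ0, abs_mul, abs_of_pos hpos] at h
  rw [hcw, abs_mul]
  exact mul_le_mul_of_nonneg_right ((le_div_iff₀ hpos).2 h) (abs_nonneg _)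

/-! ### The integral as a functional on polynomials -/

/-- Integration over `[-1, 1]`, as a linear functional on polynomials. -/
noncomputable def polyIntegral : ℝ[X] →ₗ[ℝ] ℝ where
  toFun p := ∫ x in (-1 : ℝ)..1, p.eval x
  map_add' p q := by
    simp only [eval_add]
    exact intervalIntegral.integral_add (p.continuous.intervalIntegrable _ _)
      (q.continuous.intervalIntegrable _ _)
  map_smul' c p := by simp

theorem polyIntegral_apply (p : ℝ[X]) : polyIntegral p = ∫ x in (-1 : ℝ)..1, p.eval x := rfl

theorem polyIntegral_C_mul (c : ℝ) (p : ℝ[X]) : polyIntegral (C c * p) = c * polyIntegral p := by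
  rw [← smul_eq_C_mul, map_smul, smul_eq_mul]

theorem polyIntegral_derivative (p : ℝ[X]) :
    polyIntegral (derivative p) = p.eval 1 - p.eval (-1) :=
  intervalIntegral.integral_eq_sub_of_hasDerivAt (fun x _ => p.hasDerivAt x)
    ((derivative p).continuous.intervalIntegrable _ _)

/-! ### Derivatives of polynomials that vanish to high order at `-1` and `1` -/

theorem eval_iterate_derivative_eq_zero {p : ℝ[X]} {c : ℝ} {m j : ℕ} (hp : (X - C c) ^ m ∣ p)
    (hj : j < m) : (derivative^[j] p).eval c = 0 := by
  have h := (dvd_pow_self (X - C c) (by omega : m - j ≠ 0)).trans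
    (pow_sub_dvd_iterate_derivative_of_pow_dvd j hp)
  exact dvd_iff_isRoot.1 h

/-- Integration by parts: the boundary terms vanish because `p` has zeros of order `m` at both
endpoints, and each step lowers the degree of `g`. -/
theorem polyIntegral_iterate_derivative_mul {p : ℝ[X]} {m : ℕ} (h1 : (X - C 1) ^ m ∣ p)
    (h2 : (X - C (-1)) ^ m ∣ p) {j : ℕ} (hj : j ≤ m) {g : ℝ[X]} (hg : g.degree < j) :
    polyIntegral (derivative^[j] p * g) = 0 := by
  induction j generalizing g with
  | zero =>
    have : g = 0 := by simpa [Nat.cast_zero] using hg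
    simp [this]
  | succ j ih =>
    have hg' : (derivative g).degree < j := by
      rcases eq_or_ne g 0 with rfl | h0
      · simp [bot_lt_iff_ne_bot]
      · refine (degree_derivative_lt h0).trans_le ?_
        rw [degree_eq_natDegree h0] at hg ⊢
        exact_mod_cast Nat.lt_succ_iff.1 (by exact_mod_cast hg)
    have h := polyIntegral_derivative (derivative^[j] p * g)
    rw [derivative_mul, map_add, ih (by omega) hg', eval_mul, eval_mul,
      eval_iterate_derivative_eq_zero h1 (by omega), eval_iterate_derivative_eq_zero h2 (by omega)]
      at h
    rw [Function.iterate_succ_apply']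
    linarith

/-- While `j < m` the endpoints are still zeros of the `j`-th derivative; with the `j` interior ones
they make `j + 2`, and Rolle yields `j + 1`. -/
theorem exists_finset_iterate_derivative_eq_zero {p : ℝ[X]} {m : ℕ} (h1 : (X - C 1) ^ m ∣ p)
    (h2 : (X - C (-1)) ^ m ∣ p) {j : ℕ} (hj : j ≤ m) :
    ∃ S : Finset ℝ, S.card = j ∧ ∀ x ∈ S, x ∈ Ioo (-1 : ℝ) 1 ∧ (derivative^[j] p).eval x = 0 := by
  induction j with
  | zero => exact ⟨∅, by simp⟩
  | succ j ih =>
    obtain ⟨S, hSc, hS⟩ := ih (by omega)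
    have hm1 : (1 : ℝ) ∉ S := fun h => lt_irrefl _ (hS 1 h).1.2
    have hm2 : (-1 : ℝ) ∉ insert 1 S := by
      rw [Finset.mem_insert]
      rintro (h | h)
      · norm_num at h
      · exact lt_irrefl _ (hS _ h).1.1
    have hIcc : ∀ x ∈ insert (-1) (insert 1 S), x ∈ Icc (-1 : ℝ) 1 := by
      simp only [Finset.mem_insert]
      rintro x (rfl | rfl | hx)
      · norm_num
      · norm_num
      · exact Ioo_subset_Icc_self (hS x hx).1
    have hzero : ∀ x ∈ insert (-1) (insert 1 S), (derivative^[j] p).eval x = 0 := by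
      simp only [Finset.mem_insert]
      rintro x (rfl | rfl | hx)
      · exact eval_iterate_derivative_eq_zero h2 (by omega)
      · exact eval_iterate_derivative_eq_zero h1 (by omega)
      · exact (hS x hx).2
    have hcard : (insert (-1) (insert 1 S)).card = j + 1 + 1 := by
      rw [Finset.card_insert_of_notMem hm2, Finset.card_insert_of_notMem hm1, hSc]
    obtain ⟨T, hTc, hT⟩ := exists_finset_deriv_eq_zero (derivative^[j] p).continuousOn hIcc hzero
      hcard
    refine ⟨T, hTc, fun x hx => ⟨(hT x hx).1, ?_⟩⟩
    rw [Function.iterate_succ_apply', ← Polynomial.deriv]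
    exact (hT x hx).2

/-! ### Legendre polynomials -/

theorem X_sq_sub_one_eq : (X ^ 2 - 1 : ℝ[X]) = (X - C 1) * (X - C (-1)) := by
  simp only [C_neg, C_1]
  ring

theorem legendreP_zero : legendreP 0 = 1 := by simp [legendreP]

theorem legendreP_succ (n : ℕ) :
    legendreP (n + 1) = C ((2 ^ n * (n ! : ℝ))⁻¹) * derivative^[n] ((X ^ 2 - 1) ^ n * X) := by
  have h : derivative ((X ^ 2 - 1 : ℝ[X]) ^ (n + 1)) =
      C (2 * ((n : ℝ) + 1)) * ((X ^ 2 - 1) ^ n * X) := by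
    simp only [derivative_pow, derivative_sub, derivative_X, derivative_one, C_mul, C_add, C_1,
      Nat.add_sub_cancel]
    simp
    ring
  rw [legendreP, Function.iterate_succ_apply, h, iterate_derivative_C_mul, ← mul_assoc, ← C_mul]
  congr 2
  rw [Nat.factorial_succ]
  push_cast
  have : (n ! : ℝ) ≠ 0 := by positivity
  have : (n : ℝ) + 1 ≠ 0 := by positivity
  field_simp
  ring

/-- `(x² - 1) P_n' = (n + 1) (P_{n+1} - x P_n)` and
`(x² - 1) P_{n+1}' = (n + 1) (x P_{n+1} - P_n)`. -/
theorem X_sq_sub_one_mul_derivative_legendreP (n : ℕ) :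
    (X ^ 2 - 1) * derivative (legendreP n) = ((n : ℝ[X]) + 1) * (legendreP (n + 1) - X * legendreP n) ∧
    (X ^ 2 - 1) * derivative (legendreP (n + 1)) =
      ((n : ℝ[X]) + 1) * (X * legendreP (n + 1) - legendreP n) := by
  rw [legendreP_succ]
  rcases n with _ | m
  · simp [legendreP_zero, ← sq]
  set u : ℝ[X] := (X ^ 2 - 1) ^ (m + 1) with hu
  set c : ℝ[X] := C ((2 ^ (m + 1) * ((m + 1)! : ℝ))⁻¹) with hc
  set v := derivative^[m] u with hv
  have hP : legendreP (m + 1) = c * derivative v := by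
    rw [hv, ← Function.iterate_succ_apply' derivative]
    rfl
  have hv1 : derivative^[m + 1] u = derivative v := Function.iterate_succ_apply' _ _ _
  have hv2 : derivative^[m + 2] u = derivative (derivative v) := by
    rw [Function.iterate_succ_apply', hv1]
  have hX : derivative^[m + 1] (u * X) = derivative v * X + ((m : ℝ[X]) + 1) * v := by
    rw [iterate_derivative_mul_X, hv1]
    simp [hv]
  -- The equation `(x² - 1) u' = 2 (m + 1) x u`, to be differentiated `m + 1` times by Leibniz's
  -- rule.
  have hode : derivative u * X * X - derivative u = (2 * (m + 1) : ℕ) • (u * X) := by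
    rw [hu, derivative_pow]
    simp
    ring
  have hode' := congrArg (derivative^[m + 1]) hode
  rw [iterate_derivative_sub, iterate_derivative_mul_X, iterate_derivative_derivative_mul_X,
    Nat.add_sub_cancel, iterate_derivative_derivative_mul_X, ← Function.iterate_succ_apply,
    iterate_derivative_smul, hX, hv2, hv1, ← hv] at hode'
  simp only [nsmul_eq_mul] at hode'
  push_cast at hode' ⊢
  have hdc : derivative c = 0 := derivative_C
  rw [hP, hX]
  simp only [derivative_mul, derivative_add, hdc, derivative_X, derivative_one, derivative_natCast]
  constructor
  · linear_combination c * hode'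
  · linear_combination c * X * hode'

theorem natDegree_legendreP_le (n : ℕ) : (legendreP n).natDegree ≤ n := by
  refine (natDegree_C_mul_le _ _).trans ((natDegree_iterate_derivative _ _).trans ?_)
  have : ((X ^ 2 - 1 : ℝ[X]) ^ n).natDegree ≤ n * 2 :=
    natDegree_pow_le_of_le n (by compute_degree)
  omega

/-- Compare coefficients of `x ^ (n + 1)` in the first derivative identity. -/
theorem succ_mul_coeff_legendreP_succ (n : ℕ) :
    ((n : ℝ) + 1) * (legendreP (n + 1)).coeff (n + 1) = (2 * n + 1) * (legendreP n).coeff n := by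
  have h := congrArg (fun p => coeff p (n + 1)) (X_sq_sub_one_mul_derivative_legendreP n).1
  have hd : (derivative (legendreP n)).coeff (n + 1) = 0 := by
    rw [coeff_derivative, coeff_eq_zero_of_natDegree_lt, zero_mul]
    exact (natDegree_legendreP_le n).trans_lt (by omega)
  have hc : ((n : ℝ[X]) + 1) = C ((n : ℝ) + 1) := by simp
  have hx : (X ^ 2 * derivative (legendreP n)).coeff (n + 1) = n * (legendreP n).coeff n := by
    rcases n with _ | m
    · simp [legendreP_zero]
    · rw [show m + 1 + 1 = m + 2 by rfl, coeff_X_pow_mul, coeff_derivative]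
      push_cast
      ring
  simp only [hc, sub_mul, one_mul, coeff_sub, coeff_C_mul, coeff_X_mul, hd, hx] at h
  linarith

theorem coeff_legendreP (n : ℕ) :
    (legendreP n).coeff n = (2 * n)! / (2 ^ n * (n ! : ℝ) ^ 2) := by
  induction n with
  | zero => simp [legendreP_zero]
  | succ n ih =>
    have h := succ_mul_coeff_legendreP_succ n
    have hn : (n : ℝ) + 1 ≠ 0 := by positivity
    have hf : (n ! : ℝ) ≠ 0 := by positivity
    rw [← mul_right_inj' hn, h, ih, show 2 * (n + 1) = 2 * n + 1 + 1 by ring]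
    simp only [Nat.factorial_succ]
    push_cast
    field_simp
    ring

theorem coeff_legendreP_pos (n : ℕ) : 0 < (legendreP n).coeff n := by
  rw [coeff_legendreP]
  positivity

theorem eval_one_legendreP (n : ℕ) : (legendreP n).eval 1 = 1 := by
  induction n with
  | zero => simp [legendreP_zero]
  | succ n ih =>
    have h := congrArg (eval 1) (X_sq_sub_one_mul_derivative_legendreP n).1
    simp [ih] at h
    rcases h with h | h
    · norm_cast at h
    · linarith

theorem eval_neg_one_legendreP_succ (n : ℕ) :
    (legendreP (n + 1)).eval (-1) = -(legendreP n).eval (-1) := by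
  have h := congrArg (eval (-1)) (X_sq_sub_one_mul_derivative_legendreP n).1
  simp at h
  rcases h with h | h
  · norm_cast at h
  · linarith

theorem eval_neg_one_legendreP_sq (n : ℕ) : (legendreP n).eval (-1) ^ 2 = 1 := by
  induction n with
  | zero => simp [legendreP_zero]
  | succ n ih => rw [eval_neg_one_legendreP_succ, neg_sq, ih]

theorem X_sub_one_pow_dvd (n : ℕ) : (X - C 1) ^ n ∣ (X ^ 2 - 1 : ℝ[X]) ^ n :=
  pow_dvd_pow_of_dvd (X_sq_sub_one_eq ▸ dvd_mul_right _ _) n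

theorem X_add_one_pow_dvd (n : ℕ) : (X - C (-1)) ^ n ∣ (X ^ 2 - 1 : ℝ[X]) ^ n :=
  pow_dvd_pow_of_dvd (X_sq_sub_one_eq ▸ dvd_mul_left _ _) n

theorem polyIntegral_legendreP_mul_of_degree_lt {n : ℕ} {g : ℝ[X]} (hg : g.degree < n) :
    polyIntegral (legendreP n * g) = 0 := by
  rw [legendreP, mul_assoc, polyIntegral_C_mul, polyIntegral_iterate_derivative_mul
    (X_sub_one_pow_dvd n) (X_add_one_pow_dvd n) le_rfl hg, mul_zero]

theorem polyIntegral_legendreP_mul_eq {n : ℕ} {g : ℝ[X]} (hg : g.natDegree ≤ n) :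
    polyIntegral (legendreP n * g) =
      g.coeff n / (legendreP n).coeff n * polyIntegral (legendreP n * legendreP n) := by
  set r := g.coeff n / (legendreP n).coeff n with hr
  have hdeg : (g - C r * legendreP n).degree < n := by
    rw [degree_lt_iff_coeff_zero]
    intro m hm
    rw [coeff_sub, coeff_C_mul]
    rcases hm.eq_or_lt with rfl | hm
    · rw [hr, div_mul_cancel₀ _ (coeff_legendreP_pos n).ne', sub_self]
    · rw [coeff_eq_zero_of_natDegree_lt (hg.trans_lt hm),
        coeff_eq_zero_of_natDegree_lt ((natDegree_legendreP_le n).trans_lt hm)]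
      simp
  have h := polyIntegral_legendreP_mul_of_degree_lt hdeg
  rw [mul_sub, map_sub, mul_left_comm, polyIntegral_C_mul, sub_eq_zero] at h
  exact h

/-- Integrate `(x P_n²)' = P_n² + 2 P_n (x P_n')`. The boundary terms give `2`, and `x P_n'` may be
replaced by `n P_n`, which has the same coefficient in degree `n`. -/
theorem polyIntegral_legendreP_mul_self (n : ℕ) :
    polyIntegral (legendreP n * legendreP n) = 2 / (2 * n + 1) := by
  have h := polyIntegral_derivative (X * (legendreP n * legendreP n))
  have h1 := eval_neg_one_legendreP_sq n
  have hs : derivative (X * (legendreP n * legendreP n)) = legendreP n * legendreP n +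
      C 2 * (legendreP n * (X * derivative (legendreP n))) := by
    simp only [derivative_mul, derivative_X, C_ofNat]
    ring
  have hdeg : (X * derivative (legendreP n)).natDegree ≤ n := by
    rcases Nat.eq_zero_or_pos n with rfl | hn
    · simp [legendreP_zero]
    · refine (natDegree_mul_le).trans ?_
      have := natDegree_derivative_le (legendreP n)
      have := natDegree_legendreP_le n
      rw [natDegree_X]
      omega
  have hc : (X * derivative (legendreP n)).coeff n = n * (legendreP n).coeff n := by
    rcases n with _ | m
    · simp
    · rw [coeff_X_mul, coeff_derivative]
      push_cast
      ring
  rw [hs, map_add, polyIntegral_C_mul, polyIntegral_legendreP_mul_eq hdeg, hc,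
    mul_div_cancel_right₀ _ (coeff_legendreP_pos n).ne'] at h
  simp only [eval_mul, eval_X, eval_one_legendreP] at h
  rw [eq_div_iff (by positivity)]
  linear_combination h + h1

theorem polyIntegral_legendreP_mul {n : ℕ} {g : ℝ[X]} (hg : g.natDegree ≤ n) :
    polyIntegral (legendreP n * g) = g.coeff n / (legendreP n).coeff n * (2 / (2 * n + 1)) := by
  rw [polyIntegral_legendreP_mul_eq hg, polyIntegral_legendreP_mul_self]

/-! ### Nodal polynomials and the zeros of `P_n` -/

theorem eval_nodal_id {S : Finset ℝ} {x : ℝ} (hx : x ∈ S) : (Lagrange.nodal S id).eval x = 0 :=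
  Lagrange.eval_nodal_at_node (v := id) hx

/-- A polynomial of degree at most `#S` that vanishes on `S` is a multiple of the nodal
polynomial of `S`. -/
theorem eq_C_coeff_mul_nodal {p : ℝ[X]} {S : Finset ℝ} (hp : p.natDegree ≤ S.card)
    (hS : ∀ x ∈ S, p.eval x = 0) : p = C (p.coeff S.card) * Lagrange.nodal S id := by
  have hc : (Lagrange.nodal S (id : ℝ → ℝ)).coeff S.card = 1 := by
    have h := (Lagrange.nodal_monic (s := S) (v := (id : ℝ → ℝ))).coeff_natDegree
    rwa [Lagrange.natDegree_nodal] at h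
  rw [← sub_eq_zero]
  refine eq_zero_of_degree_lt_of_eval_finset_eq_zero S ?_ fun x hx => ?_
  · rw [degree_lt_iff_coeff_zero]
    intro m hm
    rw [coeff_sub, coeff_C_mul]
    rcases hm.eq_or_lt with rfl | hm
    · rw [hc, mul_one, sub_self]
    · rw [coeff_eq_zero_of_natDegree_lt (hp.trans_lt hm), coeff_eq_zero_of_natDegree_lt
        (Lagrange.natDegree_nodal.trans_lt hm), mul_zero, sub_zero]
  · rw [eval_sub, eval_mul, hS x hx, eval_nodal_id hx, mul_zero, sub_zero]

theorem exists_legendreP_eq_nodal (n : ℕ) :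
    ∃ S : Finset ℝ, S.card = n ∧ (∀ x ∈ S, x ∈ Ioo (-1 : ℝ) 1) ∧
      legendreP n = C ((legendreP n).coeff n) * Lagrange.nodal S id := by
  obtain ⟨S, hSc, hS⟩ := exists_finset_iterate_derivative_eq_zero (X_sub_one_pow_dvd n)
    (X_add_one_pow_dvd n) le_rfl
  refine ⟨S, hSc, fun x hx => (hS x hx).1, ?_⟩
  have h := eq_C_coeff_mul_nodal (p := legendreP n) (S := S) (hSc ▸ natDegree_legendreP_le n)
    fun x hx => by rw [legendreP, eval_mul, (hS x hx).2, mul_zero]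
  rwa [hSc] at h

/-! ### The polynomial `P_n + P_{n+1}` -/

theorem X_add_one_mul_radauPoly (n : ℕ) :
    (X - C (-1)) * radauPoly (n + 1) = legendreP n + legendreP (n + 1) := by
  refine mul_divByMonic_eq_iff_isRoot.2 ?_
  rw [Nat.add_sub_cancel, IsRoot, eval_add, eval_neg_one_legendreP_succ, add_neg_cancel]

theorem natDegree_legendreP_add_succ_le (n : ℕ) :
    (legendreP n + legendreP (n + 1)).natDegree ≤ n + 1 :=
  natDegree_add_le_of_degree_le ((natDegree_legendreP_le n).trans n.le_succ)
    (natDegree_legendreP_le (n + 1))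

theorem natDegree_radauPoly_le (n : ℕ) : (radauPoly (n + 1)).natDegree ≤ n := by
  have h := natDegree_legendreP_add_succ_le n
  rw [radauPoly, natDegree_divByMonic _ (monic_X_sub_C _), natDegree_X_sub_C, Nat.add_sub_cancel]
  omega

theorem coeff_radauPoly (n : ℕ) :
    (radauPoly (n + 1)).coeff n = (legendreP (n + 1)).coeff (n + 1) := by
  have h := congrArg (fun p => coeff p (n + 1)) (X_add_one_mul_radauPoly n)
  simp only [sub_mul, coeff_sub, coeff_X_mul, coeff_C_mul, coeff_add] at h
  rwa [coeff_eq_zero_of_natDegree_lt ((natDegree_radauPoly_le n).trans_lt n.lt_succ_self),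
    coeff_eq_zero_of_natDegree_lt ((natDegree_legendreP_le n).trans_lt n.lt_succ_self), mul_zero,
    sub_zero, zero_add] at h

/-- A Rodrigues formula for the sum, which opens it to the same Rolle count of zeros as `P_n`. -/
theorem legendreP_add_succ (n : ℕ) : legendreP n + legendreP (n + 1) =
    C ((2 ^ n * (n ! : ℝ))⁻¹) * derivative^[n] ((X ^ 2 - 1) ^ n * (X + 1)) := by
  rw [legendreP_succ, legendreP, ← mul_add, ← iterate_map_add]
  congr 2
  ring

theorem exists_radauPoly_eq_nodal (n : ℕ) :
    ∃ S : Finset ℝ, S.card = n ∧ (∀ x ∈ S, x ∈ Ioo (-1 : ℝ) 1) ∧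
      radauPoly (n + 1) = C ((legendreP (n + 1)).coeff (n + 1)) * Lagrange.nodal S id := by
  obtain ⟨S, hSc, hS⟩ := exists_finset_iterate_derivative_eq_zero
    ((X_sub_one_pow_dvd n).mul_right (X + 1)) ((X_add_one_pow_dvd n).mul_right (X + 1)) le_rfl
  refine ⟨S, hSc, fun x hx => (hS x hx).1, ?_⟩
  have h := eq_C_coeff_mul_nodal (p := radauPoly (n + 1)) (S := S)
    (hSc ▸ natDegree_radauPoly_le n) fun x hx => by
      have h := congrArg (eval x) (X_add_one_mul_radauPoly n)
      rw [legendreP_add_succ, eval_mul, eval_mul, (hS x hx).2, mul_zero, mul_eq_zero] at h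
      refine h.resolve_left ?_
      have := (hS x hx).1.1
      simp only [eval_sub, eval_X, eval_C]
      linarith
  rwa [hSc, coeff_radauPoly] at h

theorem legendreP_add_succ_eq_nodal {n : ℕ} {S : Finset ℝ} (hS : ∀ x ∈ S, x ∈ Ioo (-1 : ℝ) 1)
    (h : radauPoly (n + 1) = C ((legendreP (n + 1)).coeff (n + 1)) * Lagrange.nodal S id) :
    legendreP n + legendreP (n + 1) =
      C ((legendreP (n + 1)).coeff (n + 1)) * Lagrange.nodal (insert (-1) S) id := by
  have h1 : (-1 : ℝ) ∉ S := fun h => lt_irrefl _ (hS _ h).1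
  rw [← X_add_one_mul_radauPoly, h, Lagrange.nodal_insert_eq_nodal h1, id]
  ring

theorem roots_radauPoly {n : ℕ} {S : Finset ℝ}
    (h : radauPoly (n + 1) = C ((legendreP (n + 1)).coeff (n + 1)) * Lagrange.nodal S id) :
    (radauPoly (n + 1)).roots.toFinset = S := by
  rw [h, roots_C_mul _ (coeff_legendreP_pos _).ne', Lagrange.nodal_eq]
  simp [roots_prod_X_sub_C]

theorem X_sub_one_mul_derivative_legendreP_add_succ (n : ℕ) :
    (X - 1) * derivative (legendreP n + legendreP (n + 1)) =
      ((n : ℝ[X]) + 1) * (legendreP (n + 1) - legendreP n) := by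
  obtain ⟨h1, h2⟩ := X_sq_sub_one_mul_derivative_legendreP n
  have hX : (X + 1 : ℝ[X]) ≠ 0 := by simpa using X_add_C_ne_zero (1 : ℝ)
  apply mul_left_cancel₀ hX
  rw [derivative_add]
  linear_combination h1 + h2

/-! ### Exactness of the Radau quadrature -/

theorem polyIntegral_legendreP_add_succ_mul {n : ℕ} {g : ℝ[X]} (hg : g.degree < n) :
    polyIntegral ((legendreP n + legendreP (n + 1)) * g) = 0 := by
  rw [add_mul, map_add, polyIntegral_legendreP_mul_of_degree_lt hg,
    polyIntegral_legendreP_mul_of_degree_lt (hg.trans (by exact_mod_cast n.lt_succ_self)), add_zero]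

theorem polyIntegral_legendreP_mul_monic {n : ℕ} {g : ℝ[X]} (hg : g.Monic)
    (hd : g.natDegree = n) :
    polyIntegral (legendreP n * g) = 2 / ((2 * n + 1) * (legendreP n).coeff n) := by
  have hc : g.coeff n = 1 := by rw [← hd]; exact hg.coeff_natDegree
  rw [polyIntegral_legendreP_mul hd.le, hc, div_mul_div_comm, one_mul, mul_comm (2 * (n : ℝ) + 1)]

section

variable {n : ℕ} {A : Finset ℝ}

theorem polyIntegral_nodal_mul
    (hA : legendreP n + legendreP (n + 1) =
      C ((legendreP (n + 1)).coeff (n + 1)) * Lagrange.nodal A id)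
    {g : ℝ[X]} (hg : g.degree < n) : polyIntegral (Lagrange.nodal A id * g) = 0 := by
  have h := polyIntegral_legendreP_add_succ_mul hg
  rw [hA, mul_assoc, polyIntegral_C_mul] at h
  exact (mul_eq_zero.1 h).resolve_left (coeff_legendreP_pos _).ne'

/-- Let `w_x` be the nodal polynomial without `x`. Writing `P_n = P_n(x) + (X - x) g`, the integral
of `(X - x) w_x g` vanishes by orthogonality, so that of `P_n w_x` is `P_n(x)` times that of `w_x`;
it is also explicit, `w_x` being monic of degree `n`. -/
theorem polyIntegral_nodal_erase
    (hA : legendreP n + legendreP (n + 1) =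
      C ((legendreP (n + 1)).coeff (n + 1)) * Lagrange.nodal A id)
    (hAc : A.card = n + 1) {x : ℝ} (hx : x ∈ A) :
    polyIntegral (Lagrange.nodal (A.erase x) id) * (legendreP n).eval x =
      2 / ((2 * n + 1) * (legendreP n).coeff n) := by
  have hd : (Lagrange.nodal (A.erase x) (id : ℝ → ℝ)).natDegree = n := by
    rw [Lagrange.natDegree_nodal, Finset.card_erase_of_mem hx, hAc, Nat.add_sub_cancel]
  rw [← polyIntegral_legendreP_mul_monic Lagrange.nodal_monic hd]
  set g := legendreP n /ₘ (X - C x) with hg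
  have hdiv : C ((legendreP n).eval x) + (X - C x) * g = legendreP n := by
    rw [← modByMonic_X_sub_C_eq_C_eval]
    exact modByMonic_add_div _ _
  have hP0 : legendreP n ≠ 0 := fun h => (coeff_legendreP_pos n).ne' (by rw [h, coeff_zero])
  have hgd : g.degree < n :=
    (degree_divByMonic_lt _ (X - C x) hP0 (by rw [degree_X_sub_C]; exact zero_lt_one)).trans_le
      (natDegree_le_iff_degree_le.1 (natDegree_legendreP_le n))
  have h0 := polyIntegral_nodal_mul hA hgd
  rw [Lagrange.nodal_eq_mul_nodal_erase hx, id] at h0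
  calc polyIntegral (Lagrange.nodal (A.erase x) id) * (legendreP n).eval x
      = polyIntegral (C ((legendreP n).eval x) * Lagrange.nodal (A.erase x) id) +
          polyIntegral ((X - C x) * Lagrange.nodal (A.erase x) id * g) := by
        rw [h0, polyIntegral_C_mul, add_zero, mul_comm]
    _ = polyIntegral (legendreP n * Lagrange.nodal (A.erase x) id) := by
        rw [← map_add]
        congr 1
        conv_rhs => rw [← hdiv]
        ring

/-- The interpolatory weight at any node, in a division-free form that serves both the endpoint and
the interior nodes. -/
theorem polyIntegral_basis_mul
    (hA : legendreP n + legendreP (n + 1) =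
      C ((legendreP (n + 1)).coeff (n + 1)) * Lagrange.nodal A id)
    (hAc : A.card = n + 1) {x : ℝ} (hx : x ∈ A) :
    polyIntegral (Lagrange.basis A id x) *
      (derivative (legendreP n + legendreP (n + 1))).eval x * (legendreP n).eval x * (n + 1) =
      2 := by
  have hne : (Lagrange.nodal (A.erase x) (id : ℝ → ℝ)).eval x ≠ 0 :=
    Lagrange.eval_nodal_not_at_node fun i hi h => Finset.ne_of_mem_erase hi h.symm
  have hbasis : Lagrange.basis A id x =
      C ((Lagrange.nodal (A.erase x) (id : ℝ → ℝ)).eval x)⁻¹ * Lagrange.nodal (A.erase x) id := by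
    rw [Lagrange.basis_eq_prod_sub_inv_mul_nodal_div hx,
      Lagrange.nodalWeight_eq_eval_nodal_erase_inv, Lagrange.nodal_erase_eq_nodal_div hx]
    rfl
  have hder : (derivative (legendreP n + legendreP (n + 1))).eval x =
      (legendreP (n + 1)).coeff (n + 1) * (Lagrange.nodal (A.erase x) (id : ℝ → ℝ)).eval x := by
    have h := Lagrange.eval_nodal_derivative_eval_node_eq (v := (id : ℝ → ℝ)) hx
    rw [id] at h
    rw [hA, derivative_C_mul, eval_mul, eval_C, h]
  have h1 := polyIntegral_nodal_erase hA hAc hx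
  have h2 := succ_mul_coeff_legendreP_succ n
  have h3 := coeff_legendreP_pos n
  rw [eq_div_iff (by positivity)] at h1
  rw [hbasis, hder, polyIntegral_C_mul]
  field_simp
  linear_combination h1 + polyIntegral (Lagrange.nodal (A.erase x) id) * (legendreP n).eval x * h2

/-- Gauss's argument: divide `p` by the nodal polynomial. The quotient has degree below `n`, so its
term integrates to zero; the remainder is its own interpolant. -/
theorem polyIntegral_eq_sum_basis
    (hA : legendreP n + legendreP (n + 1) =
      C ((legendreP (n + 1)).coeff (n + 1)) * Lagrange.nodal A id)
    (hAc : A.card = n + 1) {p : ℝ[X]} (hp : p.natDegree ≤ 2 * n) :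
    polyIntegral p = ∑ x ∈ A, polyIntegral (Lagrange.basis A id x) * p.eval x := by
  set w := Lagrange.nodal A (id : ℝ → ℝ) with hw
  have hmonic : w.Monic := Lagrange.nodal_monic
  have hdiv : p %ₘ w + w * (p /ₘ w) = p := modByMonic_add_div _ _
  have hq : (p /ₘ w).degree < n := by
    rcases eq_or_ne (p /ₘ w) 0 with h0 | h0
    · rw [h0, degree_zero]
      exact WithBot.bot_lt_coe _
    · rw [degree_eq_natDegree h0, natDegree_divByMonic _ hmonic, Lagrange.natDegree_nodal, hAc]
      have : ¬ p.degree < w.degree := fun h => h0 ((divByMonic_eq_zero_iff hmonic).2 h)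
      have hlt : w.natDegree ≤ p.natDegree := natDegree_le_natDegree (not_lt.1 this)
      rw [Lagrange.natDegree_nodal, hAc] at hlt
      exact_mod_cast (by omega : p.natDegree - (n + 1) < n)
  have hr : (p %ₘ w).degree < A.card := by
    have h := degree_modByMonic_lt p hmonic
    rwa [Lagrange.degree_nodal] at h
  have heval : ∀ x ∈ A, (p %ₘ w).eval x = p.eval x := fun x hx => by
    conv_rhs => rw [← hdiv]
    rw [eval_add, eval_mul, eval_nodal_id hx, zero_mul, add_zero]
  calc polyIntegral p = polyIntegral (p %ₘ w) := by
        conv_lhs => rw [← hdiv]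
        rw [map_add, polyIntegral_nodal_mul hA hq, add_zero]
    _ = ∑ x ∈ A, polyIntegral (Lagrange.basis A id x) * p.eval x := by
        rw [Lagrange.eq_interpolate (v := id) Function.injective_id.injOn hr,
          Lagrange.interpolate_apply, map_sum]
        refine Finset.sum_congr rfl fun x hx => ?_
        rw [polyIntegral_C_mul, id, heval x hx, mul_comm]

end

/-- The left Radau quadrature with `n + 1` abscissas is exact up to degree `2 n`. -/
theorem radauLeft_eval {n : ℕ} {p : ℝ[X]} (hp : p.natDegree ≤ 2 * n) :
    radauLeft (n + 1) (fun x => p.eval x) = polyIntegral p := by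
  obtain ⟨S, hSc, hS, hQ⟩ := exists_radauPoly_eq_nodal n
  have h1 : (-1 : ℝ) ∉ S := fun h => lt_irrefl _ (hS _ h).1
  have hA := legendreP_add_succ_eq_nodal hS hQ
  have hAc : (insert (-1) S).card = n + 1 := by rw [Finset.card_insert_of_notMem h1, hSc]
  have hn : (n : ℝ) + 1 ≠ 0 := by positivity
  rw [polyIntegral_eq_sum_basis hA hAc hp, Finset.sum_insert h1, radauLeft, roots_radauPoly hQ]
  have hR := X_sub_one_mul_derivative_legendreP_add_succ n
  congr 1
  · congr 1
    have h := polyIntegral_basis_mul hA hAc (Finset.mem_insert_self _ _)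
    have hR' := congrArg (eval (-1)) hR
    have hsq := eval_neg_one_legendreP_sq n
    simp only [eval_mul, eval_sub, eval_X, eval_one, eval_add, eval_natCast,
      eval_neg_one_legendreP_succ] at hR'
    have hd : (derivative (legendreP n + legendreP (n + 1))).eval (-1) =
        (n + 1) * (legendreP n).eval (-1) := by linarith
    rw [hd] at h
    rw [div_eq_iff (by positivity)]
    push_cast
    linear_combination -h + polyIntegral (Lagrange.basis (insert (-1) S) id (-1)) * (n + 1) ^ 2 * hsq
  · refine Finset.sum_congr rfl fun x hx => ?_
    congr 1
    have hxI := hS x hx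
    have hxA : x ∈ insert (-1) S := Finset.mem_insert_of_mem hx
    have h := polyIntegral_basis_mul hA hAc hxA
    have hR' := congrArg (eval x) hR
    -- At an interior node `P_{n+1} = -P_n`, so the identities reduce to `(1 - x) P_n' = (n + 1)
    -- P_n` and `(P_n + P_{n+1})' = 2 P_n'`.
    have hzero : (legendreP (n + 1)).eval x = -(legendreP n).eval x := by
      have := congrArg (eval x) hA
      rw [eval_add, eval_mul, eval_nodal_id hxA, mul_zero] at this
      linarith
    have hI := congrArg (eval x) (X_sq_sub_one_mul_derivative_legendreP n).1
    simp only [eval_mul, eval_sub, eval_X, eval_one, eval_add, eval_natCast, eval_pow,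
      hzero] at hR' hI
    have hx1 : 1 + x ≠ 0 := by linarith [hxI.1]
    have hx2 : 1 - x ≠ 0 := by linarith [hxI.2]
    have hd : (1 - x) * (derivative (legendreP n)).eval x = (n + 1) * (legendreP n).eval x := by
      apply mul_left_cancel₀ hx1
      linear_combination -hI
    have hd' : (derivative (legendreP n + legendreP (n + 1))).eval x =
        2 * (derivative (legendreP n)).eval x := by
      apply mul_left_cancel₀ hx2
      linear_combination -hR' - 2 * hd
    rw [hd'] at h
    have hmain : polyIntegral (Lagrange.basis (insert (-1) S) id x) *
        ((1 - x) * (derivative (legendreP n)).eval x ^ 2) = 1 := by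
      linear_combination h / 2 + polyIntegral (Lagrange.basis (insert (-1) S) id x) *
        (derivative (legendreP n)).eval x * hd
    rw [radauWeight, Nat.add_sub_cancel]
    exact (eq_one_div_of_mul_eq_one_left hmain).symm

/-! ### The Radau quadrature as a positive functional -/

theorem radauLeft_sub (N : ℕ) (f g : ℝ → ℝ) :
    radauLeft N (fun x => f x - g x) = radauLeft N f - radauLeft N g := by
  simp only [radauLeft, mul_sub, Finset.sum_sub_distrib]
  ring

theorem radauLeft_const_mul (N : ℕ) (c : ℝ) (f : ℝ → ℝ) :
    radauLeft N (fun x => c * f x) = c * radauLeft N f := by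
  simp only [radauLeft, mul_add, Finset.mul_sum, mul_left_comm c]

theorem mem_Ioo_of_mem_roots_radauPoly {n : ℕ} {x : ℝ}
    (hx : x ∈ (radauPoly (n + 1)).roots.toFinset) : x ∈ Ioo (-1 : ℝ) 1 := by
  obtain ⟨S, -, hS, hQ⟩ := exists_radauPoly_eq_nodal n
  exact hS x (roots_radauPoly hQ ▸ hx)

theorem radauWeight_nonneg {n : ℕ} {x : ℝ} (hx : x ∈ Ioo (-1 : ℝ) 1) : 0 ≤ radauWeight n x :=
  one_div_nonneg.2 (mul_nonneg (by linarith [hx.2]) (sq_nonneg _))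

theorem abs_radauLeft_le {n : ℕ} {f g : ℝ → ℝ} (h : ∀ x ∈ Icc (-1 : ℝ) 1, |f x| ≤ g x) :
    |radauLeft (n + 1) f| ≤ radauLeft (n + 1) g := by
  refine (abs_add_le _ _).trans (add_le_add ?_ ((Finset.abs_sum_le_sum_abs _ _).trans
    (Finset.sum_le_sum fun x hx => ?_)))
  · have h0 : (0 : ℝ) ≤ 2 / ((n + 1 : ℕ) : ℝ) ^ 2 := by positivity
    rw [abs_mul, abs_of_nonneg h0]
    exact mul_le_mul_of_nonneg_left (h _ (by norm_num)) h0
  · have hx' := mem_Ioo_of_mem_roots_radauPoly hx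
    rw [abs_mul, abs_of_nonneg (radauWeight_nonneg hx')]
    exact mul_le_mul_of_nonneg_left (h _ (Ioo_subset_Icc_self hx')) (radauWeight_nonneg hx')

theorem radauLeft_congr {n : ℕ} {f g : ℝ → ℝ} (h : ∀ x ∈ Icc (-1 : ℝ) 1, f x = g x) :
    radauLeft (n + 1) f = radauLeft (n + 1) g := by
  -- The zero majorant is written `0 * 0` so that `radauLeft_const_mul` evaluates its Radau sum.
  have h0 := abs_radauLeft_le (n := n) (f := fun x => f x - g x) (g := fun _ => 0 * 0)
    fun x hx => by simp [h x hx]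
  rw [radauLeft_const_mul, zero_mul, radauLeft_sub] at h0
  exact sub_eq_zero.1 (abs_nonpos_iff.1 h0)

/-! ### Error bounds -/

/-- The error of the Radau quadrature, bounded through interpolation at the nodes `T`. -/
theorem abs_integral_sub_radauLeft_le {n : ℕ} {f : ℝ → ℝ} (T : Finset ℝ) {M : ℝ}
    (hf : ContDiffOn ℝ T.card f (Icc (-1) 1)) (hTn : T.card ≤ 2 * n + 1)
    (hT : ∀ x ∈ T, x ∈ Icc (-1 : ℝ) 1)
    (hM : ∀ x ∈ Icc (-1 : ℝ) 1, |iteratedDerivWithin T.card f (Icc (-1) 1) x| ≤ M) :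
    |(∫ x in (-1 : ℝ)..1, f x) - radauLeft (n + 1) f| ≤ M / T.card ! *
      ((∫ x in (-1 : ℝ)..1, |(Lagrange.nodal T id).eval x|) +
        radauLeft (n + 1) fun x => |(Lagrange.nodal T id).eval x|) := by
  set p := Lagrange.interpolate T id f with hp
  have herr := fun x hx => abs_sub_interpolate_le (by norm_num : (-1 : ℝ) < 1) T hf hT hM (x := x) hx
  have hpd : p.natDegree ≤ 2 * n := by
    rcases eq_or_ne p 0 with h0 | h0
    · simp [h0]
    · have h := Lagrange.degree_interpolate_lt (v := (id : ℝ → ℝ)) f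
        (Function.injective_id.injOn (s := (T : Set ℝ)))
      rw [← hp, degree_eq_natDegree h0] at h
      have : p.natDegree < T.card := by exact_mod_cast h
      omega
  have hle : (-1 : ℝ) ≤ 1 := by norm_num
  have hfi : IntervalIntegrable f MeasureTheory.volume (-1) 1 :=
    ContinuousOn.intervalIntegrable (by rw [uIcc_of_le hle]; exact hf.continuousOn)
  have hpi : IntervalIntegrable (fun x => p.eval x) MeasureTheory.volume (-1) 1 :=
    p.continuous.intervalIntegrable _ _
  have hwi : IntervalIntegrable (fun x => M / T.card ! * |(Lagrange.nodal T id).eval x|)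
      MeasureTheory.volume (-1) 1 :=
    (continuous_const.mul (Lagrange.nodal T id).continuous.abs).intervalIntegrable _ _
  have hsplit : (∫ x in (-1 : ℝ)..1, f x) - radauLeft (n + 1) f =
      (∫ x in (-1 : ℝ)..1, f x - p.eval x) - radauLeft (n + 1) fun x => f x - p.eval x := by
    rw [radauLeft_sub, radauLeft_eval hpd, polyIntegral_apply,
      intervalIntegral.integral_sub hfi hpi]
    ring
  rw [hsplit, mul_add, ← intervalIntegral.integral_const_mul, ← radauLeft_const_mul]
  refine (abs_sub _ _).trans (add_le_add ?_ (abs_radauLeft_le herr))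
  exact (intervalIntegral.abs_integral_le_integral_abs hle).trans
    (intervalIntegral.integral_mono_on hle (hfi.sub hpi).abs hwi herr)

open Filter Topology in
/-- The error of the Radau quadrature, bounded through interpolation at simple nodes `E` and
double nodes `S`; the double nodes are limits of pairs of simple ones. -/
theorem abs_integral_sub_radauLeft_le_of_double_nodes {n k : ℕ} {f : ℝ → ℝ} (E S : Finset ℝ)
    {M : ℝ} (hk : E.card + 2 * S.card = k) (hkn : k ≤ 2 * n)
    (hE : ∀ x ∈ E, x ∈ Icc (-1 : ℝ) 1) (hS : ∀ x ∈ S, x ∈ Ioo (-1 : ℝ) 1) (hES : Disjoint E S)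
    (hE0 : ∀ x ∈ Icc (-1 : ℝ) 1, 0 ≤ (Lagrange.nodal E id).eval x)
    (hf : ContDiffOn ℝ k f (Icc (-1) 1))
    (hM : ∀ x ∈ Icc (-1 : ℝ) 1, |iteratedDerivWithin k f (Icc (-1) 1) x| ≤ M) :
    |(∫ x in (-1 : ℝ)..1, f x) - radauLeft (n + 1) f| ≤
      M / k ! * (2 * polyIntegral (Lagrange.nodal E id * Lagrange.nodal S id ^ 2)) := by
  set e := Lagrange.nodal E (id : ℝ → ℝ) with he
  set q := Lagrange.nodal S (id : ℝ → ℝ) with hq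
  -- `q(x - ε)` is the nodal polynomial of the shifted nodes `s + ε`, so `W ε` is the absolute nodal
  -- polynomial of the split nodes. At `ε = 0` it is `e q²`, of degree at most `2 n`, on which the
  -- rule is exact.
  set W : ℝ → ℝ → ℝ := fun ε x => |e.eval x * (q.eval x * q.eval (x - ε))| with hW
  set Φ : ℝ → ℝ := fun ε => (∫ x in (-1 : ℝ)..1, W ε x) + radauLeft (n + 1) (W ε) with hΦ
  have hWc : Continuous W.uncurry := by
    have h1 := e.continuous
    have h2 := q.continuous
    simp only [hW, Function.uncurry_def]
    fun_prop
  have hΦc : Continuous Φ := by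
    refine (intervalIntegral.continuous_parametric_intervalIntegral_of_continuous' hWc _ _).add ?_
    have hWx : ∀ x, Continuous fun ε => W ε x := fun x =>
      hWc.comp (continuous_id.prodMk continuous_const)
    exact (continuous_const.mul (hWx _)).add
      (continuous_finsetSum _ fun x _ => continuous_const.mul (hWx x))
  have hW0 : ∀ x ∈ Icc (-1 : ℝ) 1, W 0 x = (e * q ^ 2).eval x := fun x hx => by
    rw [hW, eval_mul, eval_pow, sq]
    simp only [sub_zero]
    exact abs_of_nonneg (mul_nonneg (hE0 x hx) (mul_self_nonneg _))
  have hdeg : (e * q ^ 2).natDegree ≤ 2 * n := by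
    have h1 : e.natDegree = E.card := Lagrange.natDegree_nodal
    have h2 : q.natDegree = S.card := Lagrange.natDegree_nodal
    have h3 := natDegree_mul_le (p := e) (q := q ^ 2)
    have h4 := natDegree_pow_le (p := q) (n := 2)
    rw [h2] at h4
    omega
  have hΦ0 : Φ 0 = 2 * polyIntegral (e * q ^ 2) := by
    rw [hΦ]
    simp only
    rw [radauLeft_congr hW0, radauLeft_eval hdeg, polyIntegral_apply,
      intervalIntegral.integral_congr (g := fun x => (e * q ^ 2).eval x)]
    · ring
    · rw [uIcc_of_le (by norm_num : (-1 : ℝ) ≤ 1)]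
      exact hW0
  have hlim : Tendsto (fun ε => M / k ! * Φ ε) (𝓝[>] 0) (𝓝 (M / k ! * Φ 0)) :=
    ((continuous_const.mul hΦc).tendsto 0).mono_left nhdsWithin_le_nhds
  rw [← hΦ0]
  refine ge_of_tendsto hlim ?_
  -- For small `ε > 0` the shifted nodes stay in the interval and avoid `E ∪ S`, so there are
  -- exactly `k` distinct nodes.
  have hev1 : ∀ᶠ ε : ℝ in 𝓝[>] 0, ∀ s ∈ S, s + ε < 1 := by
    rw [eventually_all_finset]
    intro s hs
    have h : Tendsto (fun ε : ℝ => s + ε) (𝓝[>] 0) (𝓝 (s + 0)) :=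
      ((continuous_const.add continuous_id).tendsto 0).mono_left nhdsWithin_le_nhds
    exact h.eventually (gt_mem_nhds (by linarith [(hS s hs).2]))
  have hev2 : ∀ᶠ ε : ℝ in 𝓝[>] 0, ∀ t ∈ E ∪ S, ∀ s ∈ S, s + ε ≠ t := by
    simp only [eventually_all_finset]
    intro t _ s _
    rcases eq_or_ne s t with rfl | hst
    · filter_upwards [self_mem_nhdsWithin] with ε hε
      have : 0 < ε := hε
      linarith
    · have h : Tendsto (fun ε : ℝ => s + ε) (𝓝[>] 0) (𝓝 (s + 0)) :=
        ((continuous_const.add continuous_id).tendsto 0).mono_left nhdsWithin_le_nhds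
      exact h.eventually_ne (by simpa using hst)
  filter_upwards [hev1, hev2, self_mem_nhdsWithin] with ε h1 h2 hε
  have hε0 : 0 < ε := hε
  have hinj : Function.Injective fun s : ℝ => s + ε := add_left_injective ε
  have hdisj : Disjoint (E ∪ S) (S.image fun s => s + ε) := by
    rw [Finset.disjoint_left]
    intro t ht ht'
    obtain ⟨s, hs, rfl⟩ := Finset.mem_image.1 ht'
    exact h2 _ ht s hs rfl
  set T := E ∪ S ∪ S.image fun s => s + ε with hTdef
  have hTc : T.card = k := by
    rw [hTdef, Finset.card_union_of_disjoint hdisj, Finset.card_union_of_disjoint hES,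
      Finset.card_image_of_injective _ hinj]
    omega
  have hTI : ∀ x ∈ T, x ∈ Icc (-1 : ℝ) 1 := by
    intro x hx
    rcases Finset.mem_union.1 hx with hx | hx
    · rcases Finset.mem_union.1 hx with hx | hx
      · exact hE x hx
      · exact Ioo_subset_Icc_self (hS x hx)
    · obtain ⟨s, hs, rfl⟩ := Finset.mem_image.1 hx
      exact ⟨by linarith [(hS s hs).1], (h1 s hs).le⟩
  have hnodal : ∀ x, |(Lagrange.nodal T id).eval x| = W ε x := by
    intro x
    simp only [hW, he, hq, Lagrange.eval_nodal, hTdef, id]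
    rw [Finset.prod_union hdisj, Finset.prod_union hES, Finset.prod_image hinj.injOn, mul_assoc]
    simp only [sub_sub, add_comm ε]
  have h := abs_integral_sub_radauLeft_le (n := n) T (M := M) (hTc ▸ hf) (by omega) hTI
    (hTc ▸ hM)
  simp only [hnodal, hTc] at h
  exact h

/-! ### The constants `α_k` and the final bound -/

theorem le_supNorm {g : ℝ → ℝ} (hg : ContinuousOn g (Icc (-1) 1)) {x : ℝ}
    (hx : x ∈ Icc (-1 : ℝ) 1) : |g x| ≤ supNorm g :=
  le_csSup (isCompact_Icc.bddAbove_image hg.abs) (mem_image_of_mem _ hx)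

theorem alpha_two_mul_eq (m : ℕ) : alpha (2 * m) = 2 / (2 * m)! *
    (2 / ((2 * m + 1) * (legendreP m).coeff m ^ 2)) := by
  rw [alpha_two_mul, coeff_legendreP]
  have h4 : (4 : ℝ) ^ (m + 1) = (2 ^ m) ^ 2 * 4 := by
    rw [← pow_mul, mul_comm m, pow_mul, pow_succ]
    norm_num
  rw [h4]
  field_simp
  norm_num

theorem alpha_two_mul_add_one_eq (m : ℕ) : alpha (2 * m + 1) = 2 / (2 * m + 1)! *
    (2 / ((2 * m + 1) * (legendreP m).coeff m * (legendreP (m + 1)).coeff (m + 1))) := by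
  have h := succ_mul_coeff_legendreP_succ m
  have hm : (m : ℝ) + 1 ≠ 0 := by positivity
  have h' : (legendreP (m + 1)).coeff (m + 1) =
      (2 * m + 1) * (legendreP m).coeff m / (m + 1) := by
    rw [eq_div_iff hm, mul_comm, h]
  rw [alpha_two_mul_add_one, h', coeff_legendreP, Nat.factorial_succ]
  push_cast
  have h4 : (4 : ℝ) ^ (m + 1) = (2 ^ m) ^ 2 * 4 := by
    rw [← pow_mul, mul_comm m, pow_mul, pow_succ]
    norm_num
  rw [h4]
  field_simp
  norm_num

theorem abs_integral_sub_radauLeft_le_alpha {k N : ℕ} (hN : (k + 1) / 2 < N) {f : ℝ → ℝ}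
    (hf : ContDiffOn ℝ k f (Icc (-1) 1)) :
    |(∫ x in (-1 : ℝ)..1, f x) - radauLeft N f| ≤
      alpha k * supNorm (iteratedDerivWithin k f (Icc (-1) 1)) := by
  obtain ⟨n, rfl⟩ : ∃ n, N = n + 1 := ⟨N - 1, by omega⟩
  have hM : ∀ x ∈ Icc (-1 : ℝ) 1, |iteratedDerivWithin k f (Icc (-1) 1) x| ≤
      supNorm (iteratedDerivWithin k f (Icc (-1) 1)) := fun x hx =>
    le_supNorm (hf.continuousOn_iteratedDerivWithin le_rfl (uniqueDiffOn_Icc (by norm_num))) hx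
  set M := supNorm (iteratedDerivWithin k f (Icc (-1) 1)) with hMdef
  rcases Nat.even_or_odd' k with ⟨m, rfl | rfl⟩
  · obtain ⟨S, hSc, hS, hP⟩ := exists_legendreP_eq_nodal m
    have ha := (coeff_legendreP_pos m).ne'
    -- With `P_m = a q` and `q` monic, integrate `P_m q` and divide by `a`.
    have hint : polyIntegral (Lagrange.nodal S id ^ 2) =
        2 / ((2 * m + 1) * (legendreP m).coeff m ^ 2) := by
      have h := polyIntegral_legendreP_mul_monic (n := m) (Lagrange.nodal_monic (s := S) (v := id))
        (Lagrange.natDegree_nodal.trans hSc)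
      rw [hP, mul_assoc, polyIntegral_C_mul, ← sq, ← hP] at h
      apply mul_left_cancel₀ ha
      rw [h]
      field_simp
    have h := abs_integral_sub_radauLeft_le_of_double_nodes (n := n) (k := 2 * m) (f := f) ∅ S
      (by simp [hSc]) (by omega) (by simp) hS (by simp) (by simp) hf hM
    rw [Lagrange.nodal_empty, one_mul, hint] at h
    rw [alpha_two_mul_eq]
    exact h.trans_eq (by ring)
  · obtain ⟨S, hSc, hS, hQ⟩ := exists_radauPoly_eq_nodal m
    have ha := (coeff_legendreP_pos (m + 1)).ne'
    have h1 : (-1 : ℝ) ∉ S := fun h => lt_irrefl _ (hS _ h).1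
    have hR := legendreP_add_succ_eq_nodal hS hQ
    rw [Lagrange.nodal_insert_eq_nodal h1] at hR
    have hnod : Lagrange.nodal {-1} (id : ℝ → ℝ) = X - C (-1) := by simp [Lagrange.nodal]
    -- Multiply `P_m + P_{m+1} = a (x + 1) q` by `q`, of degree `m`: the `P_{m+1}` term integrates
    -- to zero and the `P_m` term is explicit.
    have hint : polyIntegral (Lagrange.nodal {-1} id * Lagrange.nodal S id ^ 2) =
        2 / ((2 * m + 1) * (legendreP m).coeff m * (legendreP (m + 1)).coeff (m + 1)) := by
      have h := polyIntegral_legendreP_mul_monic (n := m) (Lagrange.nodal_monic (s := S) (v := id))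
        (Lagrange.natDegree_nodal.trans hSc)
      have h0 : polyIntegral (legendreP (m + 1) * Lagrange.nodal S id) = 0 :=
        polyIntegral_legendreP_mul_of_degree_lt
          (by rw [Lagrange.degree_nodal, hSc]; exact_mod_cast m.lt_succ_self)
      have h2 := congrArg (fun p => polyIntegral (p * Lagrange.nodal S id)) hR
      simp only [add_mul, map_add, h, h0, add_zero, mul_assoc, polyIntegral_C_mul, id] at h2
      rw [hnod, sq]
      apply mul_left_cancel₀ ha
      rw [← h2]
      field_simp
    have h := abs_integral_sub_radauLeft_le_of_double_nodes (n := n) (k := 2 * m + 1) (f := f)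
      {-1} S (by rw [Finset.card_singleton, hSc]; ring) (by omega) (by simp) hS (by simpa using h1)
      (fun x hx => by
        rw [hnod, eval_sub, eval_X, eval_C]
        linarith [hx.1]) hf hM
    rw [hint] at h
    rw [alpha_two_mul_add_one_eq]
    exact h.trans_eq (by ring)

/-! ### Reflection and the right rule -/

theorem supNorm_iteratedDerivWithin_comp_neg (k : ℕ) (f : ℝ → ℝ) :
    supNorm (iteratedDerivWithin k (fun x => f (-x)) (Icc (-1) 1)) =
      supNorm (iteratedDerivWithin k f (Icc (-1) 1)) := by
  have hneg : -Icc (-1 : ℝ) 1 = Icc (-1) 1 := by simp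
  unfold supNorm
  congr 1
  ext y
  simp only [mem_image, iteratedDerivWithin_comp_neg, hneg, smul_eq_mul, abs_mul, abs_pow, abs_neg,
    abs_one, one_pow, one_mul]
  constructor
  · rintro ⟨x, hx, rfl⟩
    exact ⟨-x, by rwa [← Set.mem_neg, hneg], rfl⟩
  · rintro ⟨x, hx, rfl⟩
    exact ⟨-x, by rwa [← Set.mem_neg, hneg], by rw [neg_neg]⟩

end RadauBound

theorem mainTheorem9 (k N : ℕ) (hk : 2 ≤ k) (hN : (k + 1) / 2 < N)
    (f : ℝ → ℝ) (hf : ContDiffOn ℝ (k : WithTop ℕ∞) f (Set.Icc (-1) 1)) :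
    |(∫ x in (-1 : ℝ)..1, f x) - RadauBound.radauLeft N f| ≤
        RadauBound.alpha k *
          RadauBound.supNorm (iteratedDerivWithin k f (Set.Icc (-1) 1)) ∧
      |(∫ x in (-1 : ℝ)..1, f x) - RadauBound.radauRight N f| ≤
        RadauBound.alpha k *
          RadauBound.supNorm (iteratedDerivWithin k f (Set.Icc (-1) 1)) := by
  refine ⟨RadauBound.abs_integral_sub_radauLeft_le_alpha hN hf, ?_⟩
  have hf' : ContDiffOn ℝ k (fun x => f (-x)) (Set.Icc (-1) 1) :=
    hf.comp contDiff_neg.contDiffOn fun x hx => ⟨by linarith [hx.2], by linarith [hx.1]⟩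
  have h := RadauBound.abs_integral_sub_radauLeft_le_alpha hN hf'
  rw [RadauBound.supNorm_iteratedDerivWithin_comp_neg, intervalIntegral.integral_comp_neg,
    neg_neg] at h
  exact h
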